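/- Let $n,m,p,\ell$ be nonnegative integers with $\ell\le p$, put $I:=\{1,\dots,\ell\}$ and $J:=\{\ell+1,\dots,p\}$, let $h_1,\dots,h_p\colon\mathbb R^n\times\mathbb R^m\to\mathbb R$, and consider the set-valued mapping $\Gamma\colon\mathbb R^n\rightrightarrows\mathbb R^m$, $$\Gamma(x):=\{y\in\mathbb R^m : h_i(x,y)\le 0\ (i\in I),\ h_i(x,y)=0\ (i\in J)\},\qquad \operatorname{dom}\Gamma:=\{x:\Gamma(x)\ne\varnothing\}.$$ Fix $\bar x\in\operatorname{dom}\Gamma$. Suppose that on some open set containing $\{\bar x\}\times\Gamma(\bar x)$ all $h_i$ are continuous, are differentiable with respect to $y$, and have (jointly) continuous partial gradients $\nabla_y h_i$. A pair of finite families of vectors $((a^i)_{i\in I_1},(b^i)_{i\in I_2})$ is called positive-linearly dependent if there are scalars $\alpha_i\ge 0$ $(i\in I_1)$ and $\beta_i\in\mathbb R$ $(i\in I_2)$, not all zero, with $\sum_{i\in I_1}\alpha_ia^i+\sum_{i\in I_2}\beta_ib^i=0$. For $\bar y\in\Gamma(\bar x)$ let $I(\bar x,\bar y):=\{i\in I: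 h_i(\bar x,\bar y)=0\}$. The relaxed constant positive linear dependence constraint qualification (RCPLD) holds at $(\bar x,\bar y)$ w.r.t. $\Omega\subset\mathbb R^n$ if there are a neighborhood $U$ of $(\bar x,\bar y)$ and a set $S\subset J$ such that (i) the family $(\nabla_yh_i(\bar x,\bar y))_{i\in S}$ is a basis of the span of $\{\nabla_yh_i(\bar x,\bar y): i\in J\}$; (ii) the family $(\nabla_yh_i(x,y))_{i\in J}$ has constant rank on $U\cap(\Omega\times\mathbb R^m)$; (iii) for each $K\subset I(\bar x,\bar y)$ such that the pair $\big((\nabla_yh_i(\bar x,\bar y))_{i\in K},(\nabla_yh_i(\bar x,\bar y))_{i\in S}\big)$ is positive-linearly dependent, the family $(\nabla_yh_i(x,y))_{i\in K\cup S}$ is linearly dependent for every $(x,y)\in U\cap(\Omega\times\mathbb R^m)$. The mapping $\Gamma$ is called R-regular at $(\bar x,\bar y)$ w.r.t. $\Omega$ if there are $\kappa>0$ and a neighborhood $U$ of $(\bar x,\bar y)$ such that for all $(x,y)\in U\cap(\Omega\times\mathbb R^m)$ $$\operatorname{dist}(y,\Gamma(x))\le\kappa\,\max\big\{0,\ \max\{h_i(x,y):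 i\in I\},\ \max\{|h_i(x,y)|: i\in J\}\big\},$$ where $\operatorname{dist}$ is the Euclidean distance and maxima over empty index sets are omitted. **Theorem.** Assume (A1) for each $x\in\mathbb R^n$, the functions $h_i(x,\cdot)$, $i\in I$, are convex on $\mathbb R^m$ and the functions $h_i(x,\cdot)$, $i\in J$, are affine; (A2) $\Gamma$ is locally bounded at $\bar x$, i.e., there are a bounded set $B\subset\mathbb R^m$ and a neighborhood $V$ of $\bar x$ with $\Gamma(x)\subset B$ for all $x\in V$. If RCPLD holds w.r.t. $\operatorname{dom}\Gamma$ at each point of $\{\bar x\}\times\Gamma(\bar x)$, then $\Gamma$ is R-regular w.r.t. $\operatorname{dom}\Gamma$ at each point of $\{\bar x\}\times\Gamma(\bar x)$. -/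

import Mathlib

open scoped Topology

namespace ParametricConstraints

/-- The index set `I = {1, …, ℓ}` of the inequality constraints among `p` constraints
(numbered from `0`). -/
def ineqIdx (p ℓ : ℕ) : Finset (Fin p) := Finset.univ.filter fun i => i.val < ℓ

/-- The index set `J = {ℓ + 1, …, p}` of the equality constraints among `p` constraints
(numbered from `0`). -/
def eqIdx (p ℓ : ℕ) : Finset (Fin p) := Finset.univ.filter fun i => ℓ ≤ i.val

/-- The domain of a set-valued mapping. -/
def setDom {X Y : Type*} (Υ : X → Set Y) : Set X := {x | (Υ x).Nonempty}

/-- A set-valued mapping is locally bounded at `x₀` if its images at all points of a neighborhood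
of `x₀` lie in one bounded set. -/
def LocallyBoundedAt {X Y : Type*} [TopologicalSpace X] [Bornology Y]
    (Υ : X → Set Y) (x₀ : X) : Prop :=
  ∃ B : Set Y, Bornology.IsBounded B ∧ ∃ U ∈ 𝓝 x₀, ∀ x ∈ U, Υ x ⊆ B

/-- The pair of finite families `((a i)_i, (b j)_j)` is positive-linearly dependent: some
combination with coefficients `α i ≥ 0` and `β j ∈ ℝ`, not all zero, vanishes. -/
def PosLinDep {ι₁ ι₂ V : Type*} [Fintype ι₁] [Fintype ι₂] [AddCommGroup V] [Module ℝ V]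
    (a : ι₁ → V) (b : ι₂ → V) : Prop :=
  ∃ (α : ι₁ → ℝ) (β : ι₂ → ℝ), (∀ i, 0 ≤ α i) ∧ ((∃ i, α i ≠ 0) ∨ (∃ j, β j ≠ 0)) ∧
    ∑ i, α i • a i + ∑ j, β j • b j = 0

/-- The set-valued mapping
`Γ(x) = {y | h_i(x, y) ≤ 0 for i ∈ I, h_i(x, y) = 0 for i ∈ J}`. -/
def feasMap {n m p : ℕ} (ℓ : ℕ)
    (h : Fin p → EuclideanSpace ℝ (Fin n) → EuclideanSpace ℝ (Fin m) → ℝ)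
    (x : EuclideanSpace ℝ (Fin n)) : Set (EuclideanSpace ℝ (Fin m)) :=
  {y | (∀ i ∈ ineqIdx p ℓ, h i x y ≤ 0) ∧ (∀ i ∈ eqIdx p ℓ, h i x y = 0)}

/-- The partial gradient `∇_y h_i(x, y)`. -/
noncomputable def gradY {n m p : ℕ}
    (h : Fin p → EuclideanSpace ℝ (Fin n) → EuclideanSpace ℝ (Fin m) → ℝ)
    (i : Fin p) (x : EuclideanSpace ℝ (Fin n)) (y : EuclideanSpace ℝ (Fin m)) :
    EuclideanSpace ℝ (Fin m) :=
  gradient (h i x) y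

/-- All `h_i` are continuous, and continuously differentiable with respect to `y`, on an open set
containing `{x₀} × Γ(x₀)`. -/
def SmoothNear {n m p : ℕ} (ℓ : ℕ)
    (h : Fin p → EuclideanSpace ℝ (Fin n) → EuclideanSpace ℝ (Fin m) → ℝ)
    (x₀ : EuclideanSpace ℝ (Fin n)) : Prop :=
  ∃ O : Set (EuclideanSpace ℝ (Fin n) × EuclideanSpace ℝ (Fin m)),
    IsOpen O ∧ ({x₀} : Set (EuclideanSpace ℝ (Fin n))) ×ˢ feasMap ℓ h x₀ ⊆ O ∧
    ∀ i, ContinuousOn (fun q => h i q.1 q.2) O ∧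
      (∀ q ∈ O, DifferentiableAt ℝ (h i q.1) q.2) ∧
      ContinuousOn (fun q => gradY h i q.1 q.2) O

/-- The set `I(x, y)` of inequality constraints active at `(x, y)`. -/
def activeIdx {n m p : ℕ} (ℓ : ℕ)
    (h : Fin p → EuclideanSpace ℝ (Fin n) → EuclideanSpace ℝ (Fin m) → ℝ)
    (x : EuclideanSpace ℝ (Fin n)) (y : EuclideanSpace ℝ (Fin m)) : Set (Fin p) :=
  {i | i ∈ ineqIdx p ℓ ∧ h i x y = 0}

/-- The relaxed constant positive linear dependence constraint qualification at `(x₀, y₀)` with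
respect to `Ω`. "Basis" in the first condition is meant for the family indexed by `S`. -/
def RCPLD {n m p : ℕ} (ℓ : ℕ)
    (h : Fin p → EuclideanSpace ℝ (Fin n) → EuclideanSpace ℝ (Fin m) → ℝ)
    (Ω : Set (EuclideanSpace ℝ (Fin n)))
    (x₀ : EuclideanSpace ℝ (Fin n)) (y₀ : EuclideanSpace ℝ (Fin m)) : Prop :=
  ∃ U ∈ 𝓝 (x₀, y₀), ∃ S : Finset (Fin p), S ⊆ eqIdx p ℓ ∧
    (LinearIndependent ℝ (fun i : S => gradY h i x₀ y₀) ∧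
      Submodule.span ℝ ((fun i => gradY h i x₀ y₀) '' (S : Set (Fin p))) =
        Submodule.span ℝ ((fun i => gradY h i x₀ y₀) '' (eqIdx p ℓ : Set (Fin p)))) ∧
    (∃ r : ℕ, ∀ x y, (x, y) ∈ U → x ∈ Ω →
      Module.finrank ℝ (Submodule.span ℝ
        ((fun i => gradY h i x y) '' (eqIdx p ℓ : Set (Fin p)))) = r) ∧
    (∀ K : Finset (Fin p), (K : Set (Fin p)) ⊆ activeIdx ℓ h x₀ y₀ →
      PosLinDep (fun i : K => gradY h i x₀ y₀) (fun i : S => gradY h i x₀ y₀) →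
      ∀ x y, (x, y) ∈ U → x ∈ Ω →
        ¬ LinearIndependent ℝ (fun i : (K ∪ S : Finset (Fin p)) => gradY h i x y))

/-- The constraint violation
`max {0, max {h_i(x, y) | i ∈ I}, max {|h_i(x, y)| | i ∈ J}}`.
The suprema run over finite sets, so they are maxima; over an empty index set they are `0`, which
does not affect the outer maximum. -/
noncomputable def violation {n m p : ℕ} (ℓ : ℕ)
    (h : Fin p → EuclideanSpace ℝ (Fin n) → EuclideanSpace ℝ (Fin m) → ℝ)
    (x : EuclideanSpace ℝ (Fin n)) (y : EuclideanSpace ℝ (Fin m)) : ℝ :=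
  max 0 (max (⨆ i : ineqIdx p ℓ, h i x y) (⨆ i : eqIdx p ℓ, |h i x y|))

/-- `Γ` is R-regular at `(x₀, y₀)` with respect to `Ω`. The distance is extended-valued, so the
distance to an empty set is `∞`. -/
def RRegularAt {n m p : ℕ} (ℓ : ℕ)
    (h : Fin p → EuclideanSpace ℝ (Fin n) → EuclideanSpace ℝ (Fin m) → ℝ)
    (Ω : Set (EuclideanSpace ℝ (Fin n)))
    (x₀ : EuclideanSpace ℝ (Fin n)) (y₀ : EuclideanSpace ℝ (Fin m)) : Prop :=
  ∃ κ : ℝ, 0 < κ ∧ ∃ U ∈ 𝓝 (x₀, y₀), ∀ x y, (x, y) ∈ U → x ∈ Ω →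
    Metric.infEDist y (feasMap ℓ h x) ≤ ENNReal.ofReal (κ * violation ℓ h x y)

end ParametricConstraints

open ParametricConstraints

/-! Fix `x` in the domain near `x₀` and any `y`. A point of `Γ(x)` close enough to `y` arises as a
limit of minimizers `z` of a quadratic penalty: `‖u - y‖²` plus `ρ` times the squared residuals.
Stationarity writes `y - z` as a combination of the gradients at `z`, with nonnegative weights on
the inequalities, which vanish unless the inequality is violated at `z`. If multipliers of norm at
most `C‖y - z‖` can be chosen, pairing this identity with `y - z` and using the gradient inequality
bounds `‖y - z‖` by `C` times the sum of violation at `y` and residuals at `z`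
(`norm_sub_le_of_bounded_multipliers`). The residuals vanish in the limit.

RCPLD provides such multipliers (`exists_eventually_bounded_multipliers`). Constant rank keeps `S` a
basis for the equality gradients, so their part moves onto `S`; a Carathéodory reduction leaves a
set `K` of violated inequalities with `K ∪ S` independent at the current point. By the third RCPLD
condition, `K` and `S` are then not positive-linearly dependent at the base point, so the
combination map is bounded below on the cone of multipliers, a property stable under perturbation.
There are finitely many `K`.

One `C` serves all `z`: `Γ(x₀)` is compact, and convexity keeps `Γ(x)` in a small thickening of it
(`eventually_zeroSet_subset_thickening`). -/

section LinearAlgebra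

/-! ### Linear algebra: cones of multipliers and their stability -/

variable {ι E X : Type*}

/-- Coefficient vectors which are nonnegative on `s` and vanish outside `T`. -/
def coeffCone (s T : Finset ι) : Set (ι → ℝ) := {w | (∀ i ∈ s, 0 ≤ w i) ∧ ∀ i ∉ T, w i = 0}

theorem isClosed_coeffCone (s T : Finset ι) : IsClosed (coeffCone s T) := by
  have : coeffCone s T = (⋂ i ∈ s, {w : ι → ℝ | 0 ≤ w i}) ∩ ⋂ i ∈ {i | i ∉ T}, {w | w i = 0} := by
    ext w; simp [coeffCone]
  rw [this]
  exact (isClosed_biInter fun i _ => isClosed_le continuous_const (continuous_apply i)).inter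
    (isClosed_biInter fun i _ => isClosed_eq (continuous_apply i) continuous_const)

theorem smul_mem_coeffCone {s T : Finset ι} {w : ι → ℝ} (hw : w ∈ coeffCone s T) {c : ℝ}
    (hc : 0 ≤ c) : c • w ∈ coeffCone s T :=
  ⟨fun i hi => mul_nonneg hc (hw.1 i hi), fun i hi => by simp [hw.2 i hi]⟩

variable [NormedAddCommGroup E] [NormedSpace ℝ E]

/-- A linearly independent subfamily of full rank spans the same subspace as the whole family. -/
theorem span_image_eq_of_finrank_eq {g : ι → E} {S J : Finset ι} (hSJ : S ⊆ J)
    (hS : LinearIndepOn ℝ g (S : Set ι))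
    (hr : Module.finrank ℝ (Submodule.span ℝ (g '' (J : Set ι))) = S.card) :
    Submodule.span ℝ (g '' (S : Set ι)) = Submodule.span ℝ (g '' (J : Set ι)) := by
  have hfin : FiniteDimensional ℝ (Submodule.span ℝ (g '' (J : Set ι))) :=
    FiniteDimensional.span_of_finite ℝ (J.finite_toSet.image g)
  refine Submodule.eq_of_le_of_finrank_eq
    (Submodule.span_mono (Set.image_mono (Finset.coe_subset.2 hSJ))) ?_
  rw [hr, Set.image_eq_range, finrank_span_eq_card hS]
  simp

variable [Fintype ι]

/-- A linear combination map with trivial kernel on a cone of coefficients is bounded below there. -/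
theorem exists_mul_norm_le_of_coeffCone (g : ι → E) (s T : Finset ι)
    (hinj : ∀ w ∈ coeffCone s T, ∑ i, w i • g i = 0 → w = 0) :
    ∃ c > 0, ∀ w ∈ coeffCone s T, c * ‖w‖ ≤ ‖∑ i, w i • g i‖ := by
  have hK : IsCompact (coeffCone s T ∩ Metric.sphere 0 1) :=
    (isCompact_sphere 0 1).inter_left (isClosed_coeffCone s T)
  have hnorm : ∀ c : ℝ, (∀ w ∈ coeffCone s T ∩ Metric.sphere 0 1, c ≤ ‖∑ i, w i • g i‖) →
      ∀ w ∈ coeffCone s T, c * ‖w‖ ≤ ‖∑ i, w i • g i‖ := by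
    intro c hc w hw
    rcases eq_or_ne w 0 with rfl | hw0
    · simp
    have hpos : 0 < ‖w‖ := norm_pos_iff.2 hw0
    have h1 := hc (‖w‖⁻¹ • w) ⟨smul_mem_coeffCone hw (inv_nonneg.2 hpos.le), by
      simp [norm_smul, hpos.ne']⟩
    have h2 : ∑ i, (‖w‖⁻¹ • w) i • g i = ‖w‖⁻¹ • ∑ i, w i • g i := by
      simp [Finset.smul_sum, smul_smul]
    rw [h2, norm_smul, norm_inv, norm_norm, inv_mul_eq_div, le_div_iff₀ hpos] at h1
    exact h1
  rcases (coeffCone s T ∩ Metric.sphere 0 1).eq_empty_or_nonempty with he | hne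
  · exact ⟨1, one_pos, hnorm 1 (by simp [he])⟩
  obtain ⟨w₀, hw₀, hmin⟩ := hK.exists_isMinOn hne
    (f := fun w : ι → ℝ => ‖∑ i, w i • g i‖) (by fun_prop)
  refine ⟨‖∑ i, w₀ i • g i‖, norm_pos_iff.2 fun h0 => ?_, hnorm _ fun w hw => hmin hw⟩
  have := hinj w₀ hw₀.1 h0
  have h1 := hw₀.2
  simp [this] at h1

variable [TopologicalSpace X]

/-- Moving the generators by less than `c / 2` in total changes a combination by at most `c / 2 *
‖w‖`, so half of the bound at `q₀` survives, uniformly in `w`. -/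
theorem eventually_mul_norm_le_of_coeffCone {g : X → ι → E} {q₀ : X} (hg : ContinuousAt g q₀)
    (s T : Finset ι) (hinj : ∀ w ∈ coeffCone s T, ∑ i, w i • g q₀ i = 0 → w = 0) :
    ∃ c > 0, ∀ᶠ q in 𝓝 q₀, ∀ w ∈ coeffCone s T, c * ‖w‖ ≤ ‖∑ i, w i • g q i‖ := by
  obtain ⟨c, hc, hb⟩ := exists_mul_norm_le_of_coeffCone (g q₀) s T hinj
  refine ⟨c / 2, half_pos hc, ?_⟩
  have hsum : ContinuousAt (fun q => ∑ i, ‖g q i - g q₀ i‖) q₀ := by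
    have : ∀ i, ContinuousAt (fun q => g q i) q₀ := fun i => continuousAt_pi.1 hg i
    fun_prop
  have h0 : (∑ i, ‖g q₀ i - g q₀ i‖) < c / 2 := by simpa using half_pos hc
  filter_upwards [hsum.eventually_lt_const h0] with q hq w hw
  have h1 : ‖∑ i, w i • g q₀ i‖ ≤ ‖∑ i, w i • g q i‖ + ‖w‖ * ∑ i, ‖g q i - g q₀ i‖ := by
    have h2 : ∑ i, w i • g q₀ i = ∑ i, w i • g q i - ∑ i, w i • (g q i - g q₀ i) := by
      simp [smul_sub]
    rw [h2]
    refine (norm_sub_le _ _).trans (add_le_add_right ?_ _)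
    rw [Finset.mul_sum]
    refine (norm_sum_le _ _).trans (Finset.sum_le_sum fun i _ => ?_)
    rw [norm_smul]
    exact mul_le_mul_of_nonneg_right (norm_le_pi_norm w i) (norm_nonneg _)
  have h3 := hb w hw
  have h4 := mul_le_mul_of_nonneg_left hq.le (norm_nonneg w)
  linarith

variable [DecidableEq ι]

/-- Carathéodory reduction keeping a linearly independent subfamily `S`. -/
theorem exists_linearIndepOn_conic_comb (g : ι → E) {s S : Finset ι} (hsS : Disjoint s S)
    (hS : LinearIndepOn ℝ g (S : Set ι)) (K : Finset ι) (hK : K ⊆ s) (w : ι → ℝ)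
    (hw : w ∈ coeffCone s (K ∪ S)) :
    ∃ K' ⊆ K, ∃ w' ∈ coeffCone s (K' ∪ S), LinearIndepOn ℝ g ((K' ∪ S : Finset ι) : Set ι) ∧
      ∑ i, w' i • g i = ∑ i, w i • g i := by
  induction K using Finset.strongInduction generalizing w with
  | H K ih =>
  by_cases hind : LinearIndepOn ℝ g ((K ∪ S : Finset ι) : Set ι)
  · exact ⟨K, subset_rfl, w, hw, hind, rfl⟩
  rw [linearIndepOn_finset_iff] at hind
  push Not at hind
  obtain ⟨a, ha, i₀, hi₀, hai₀⟩ := hind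
  -- A relation supported on `S` alone would contradict the independence of `S`.
  have hex : ∃ i ∈ K, a i ≠ 0 := by
    by_contra! hcon
    have h1 : ∑ i ∈ S, a i • g i = 0 := by
      rw [← ha]
      refine Finset.sum_subset Finset.subset_union_right fun i hi hiS => ?_
      rcases Finset.mem_union.1 hi with h | h
      · simp [hcon i h]
      · exact absurd h hiS
    have h2 := linearIndepOn_finset_iff.1 hS a h1
    rcases Finset.mem_union.1 hi₀ with h | h
    · exact hai₀ (hcon _ h)
    · exact hai₀ (h2 _ h)
  have hpos : ∃ b : ι → ℝ, ∑ i ∈ K ∪ S, b i • g i = 0 ∧ ∃ i ∈ K, 0 < b i := by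
    obtain ⟨i, hi, hai⟩ := hex
    rcases lt_or_gt_of_ne hai with h | h
    · exact ⟨fun i => - a i, by simp [ha], i, hi, by simpa using h⟩
    · exact ⟨a, ha, i, hi, h⟩
  obtain ⟨b, hb, i₁, hi₁, hbi₁⟩ := hpos
  -- Ratio test: subtracting the smallest ratio times `b` keeps the weights on `K` nonnegative and
  -- kills the one at `j`. Weights on `S` carry no sign condition.
  obtain ⟨j, hj, hjmin⟩ := (K.filter fun i => 0 < b i).exists_min_image (fun i => w i / b i)
    ⟨i₁, Finset.mem_filter.2 ⟨hi₁, hbi₁⟩⟩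
  rw [Finset.mem_filter] at hj
  set t := w j / b j with ht
  have ht0 : 0 ≤ t := div_nonneg (hw.1 j (hK hj.1)) hj.2.le
  let w₁ : ι → ℝ := fun i => if i ∈ K ∪ S then w i - t * b i else 0
  have hw₁ : w₁ ∈ coeffCone s (K.erase j ∪ S) := by
    refine ⟨fun i hi => ?_, fun i hi => ?_⟩
    · simp only [w₁]
      split_ifs with h
      · have hiK : i ∈ K := (Finset.mem_union.1 h).resolve_right
          (Finset.disjoint_left.1 hsS hi)
        rcases le_or_gt (b i) 0 with hbi | hbi
        · have := hw.1 i hi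
          nlinarith
        · have := hjmin i (Finset.mem_filter.2 ⟨hiK, hbi⟩)
          rw [le_div_iff₀ hbi] at this
          linarith
      · exact le_rfl
    · simp only [w₁]
      split_ifs with h
      · have hij : i = j := by
          by_contra hne
          apply hi
          rcases Finset.mem_union.1 h with h | h
          · exact Finset.mem_union_left _ (Finset.mem_erase.2 ⟨hne, h⟩)
          · exact Finset.mem_union_right _ h
        rw [hij, ht, div_mul_cancel₀ _ hj.2.ne', sub_self]
      · rfl
  have hsum : ∑ i, w₁ i • g i = ∑ i, w i • g i := by
    have h1 : ∑ i, w i • g i = ∑ i ∈ K ∪ S, w i • g i :=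
      (Finset.sum_subset (Finset.subset_univ _) fun i _ hi => by simp [hw.2 i hi]).symm
    have h2 : ∑ i, w₁ i • g i = ∑ i ∈ K ∪ S, (w i - t * b i) • g i := by
      rw [← Finset.sum_subset (Finset.subset_univ (K ∪ S)) fun i _ hi => by
        simp only [w₁, if_neg hi, zero_smul]]
      exact Finset.sum_congr rfl fun i hi => by simp only [w₁, if_pos hi]
    rw [h1, h2]
    simp only [sub_smul, mul_smul, Finset.sum_sub_distrib, ← Finset.smul_sum, hb, smul_zero,
      sub_zero]
  obtain ⟨K', hK', w', hw', hli, hs⟩ := ih (K.erase j) (Finset.erase_ssubset hj.1)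
    ((Finset.erase_subset _ _).trans hK) w₁ hw₁
  exact ⟨K', hK'.trans (Finset.erase_subset _ _), w', hw', hli, hs.trans hsum⟩

theorem LinearIndepOn.eq_zero_of_mem_coeffCone {g : ι → E} {s T : Finset ι}
    (h : LinearIndepOn ℝ g (T : Set ι)) {w : ι → ℝ} (hw : w ∈ coeffCone s T)
    (h0 : ∑ i, w i • g i = 0) : w = 0 := by
  rw [← Finset.sum_subset (Finset.subset_univ T) fun i _ hi => by simp [hw.2 i hi]] at h0
  ext i
  by_cases hi : i ∈ T
  · exact linearIndepOn_finset_iff.1 h w h0 i hi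
  · exact hw.2 i hi

theorem eventually_linearIndepOn {g : X → ι → E} {q₀ : X} (hg : ContinuousAt g q₀)
    {S : Finset ι} (hS : LinearIndepOn ℝ (g q₀) (S : Set ι)) :
    ∀ᶠ q in 𝓝 q₀, LinearIndepOn ℝ (g q) (S : Set ι) := by
  -- With no sign constraints the cone is a subspace, and the lower bound says that `S` is
  -- independent.
  obtain ⟨c, hc, hev⟩ := eventually_mul_norm_le_of_coeffCone hg ∅ S
    fun w hw h0 => hS.eq_zero_of_mem_coeffCone hw h0
  filter_upwards [hev] with q hq
  rw [linearIndepOn_finset_iff]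
  intro a ha i hi
  have h1 := hq (fun i => if i ∈ S then a i else 0)
    ⟨by simp, fun i hi => by simp [hi]⟩
  have h2 : ∑ i, (if i ∈ S then a i else 0) • g q i = 0 := by
    simpa [ite_smul] using ha
  rw [h2, norm_zero] at h1
  have h3 : ‖fun i => if i ∈ S then a i else 0‖ = 0 :=
    le_antisymm (nonpos_of_mul_nonpos_right h1 hc) (norm_nonneg _)
  simpa [hi] using congrFun (norm_eq_zero.1 h3) i

/-- Moves all equality multipliers onto the basis `S` while leaving the inequality multipliers
untouched. -/
theorem exists_mem_coeffCone_sum_eq {g : ι → E} {s S : Finset ι} (hsS : Disjoint s S)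
    (hspan : Submodule.span ℝ (g '' (S : Set ι)) =
      Submodule.span ℝ (g '' ((sᶜ : Finset ι) : Set ι)))
    {w : ι → ℝ} (hw : ∀ i ∈ s, 0 ≤ w i) :
    ∃ w' ∈ coeffCone s (s.filter (fun i => w i ≠ 0) ∪ S),
      ∑ i, w' i • g i = ∑ i, w i • g i := by
  have hmem : ∑ i ∈ sᶜ, w i • g i ∈ Submodule.span ℝ (g '' (S : Set ι)) := by
    rw [hspan]
    exact Submodule.sum_mem _ fun i hi => Submodule.smul_mem _ _
      (Submodule.subset_span ⟨i, hi, rfl⟩)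
  obtain ⟨a, ha⟩ := (Submodule.mem_span_image_finset_iff_exists_fun' ℝ).1 hmem
  refine ⟨fun i => if i ∈ s then w i else if i ∈ S then a i else 0,
    ⟨fun i hi => by simpa [hi] using hw i hi, fun i hi => ?_⟩, ?_⟩
  · rw [Finset.mem_union, Finset.mem_filter, not_or] at hi
    by_cases his : i ∈ s
    · simpa [his] using hi.1
    · simp [his, hi.2]
  · rw [← Finset.sum_add_sum_compl s, ← Finset.sum_add_sum_compl s (fun i => w i • g i)]
    congr 1
    · exact Finset.sum_congr rfl fun i hi => by simp [hi]
    · rw [← ha, ← Finset.sum_subset (s₁ := S)]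
      · exact Finset.sum_congr rfl fun i hi => by simp [hi, Finset.disjoint_right.1 hsS hi]
      · exact fun i hi => Finset.mem_compl.2 (Finset.disjoint_right.1 hsS hi)
      · intro i hi hiS
        simp [hiS, Finset.mem_compl.1 hi]

/-- Near a base point satisfying the relaxed constant positive linear dependence condition,
multipliers may be replaced by multipliers of no larger support among the inequality indices whose
size is controlled by the represented vector. -/
theorem exists_eventually_bounded_multipliers {g : X → ι → E} {f : X → ι → ℝ} {q₀ : X}
    (hg : ContinuousAt g q₀) (hf : ContinuousAt f q₀) {Ω : Set X} (hq₀ : q₀ ∈ Ω) {s S : Finset ι}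
    (hsS : Disjoint s S) (hf₀ : ∀ i ∈ s, f q₀ i ≤ 0)
    (hS : LinearIndepOn ℝ (g q₀) (S : Set ι))
    (hspan : Submodule.span ℝ (g q₀ '' (S : Set ι)) =
      Submodule.span ℝ (g q₀ '' ((sᶜ : Finset ι) : Set ι)))
    {r : ℕ} {U : Set X} (hU : U ∈ 𝓝 q₀)
    (hr : ∀ q ∈ U, q ∈ Ω →
      Module.finrank ℝ (Submodule.span ℝ (g q '' ((sᶜ : Finset ι) : Set ι))) = r)
    (hK : ∀ K ⊆ s, (∀ i ∈ K, f q₀ i = 0) →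
      (∃ w ∈ coeffCone s (K ∪ S), w ≠ 0 ∧ ∑ i, w i • g q₀ i = 0) →
      ∀ q ∈ U, q ∈ Ω → ¬ LinearIndepOn ℝ (g q) ((K ∪ S : Finset ι) : Set ι)) :
    ∃ C : ℝ, ∀ᶠ q in 𝓝 q₀, q ∈ Ω → ∀ w : ι → ℝ, (∀ i ∈ s, 0 ≤ w i) →
      (∀ i ∈ s, w i ≠ 0 → 0 < f q i) →
      ∃ w' : ι → ℝ, (∀ i ∈ s, 0 ≤ w' i) ∧ (∀ i ∈ s, w' i ≠ 0 → 0 < f q i) ∧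
        ∑ i, w' i • g q i = ∑ i, w i • g q i ∧ ‖w'‖ ≤ C * ‖∑ i, w i • g q i‖ := by
  have hcard : r = S.card := by
    rw [← hr q₀ (mem_of_mem_nhds hU) hq₀, ← hspan, Set.image_eq_range, finrank_span_eq_card hS]
    simp
  have hbound : ∀ K : Finset ι, ∃ C : ℝ, 0 ≤ C ∧ ∀ᶠ q in 𝓝 q₀, q ∈ Ω → K ⊆ s →
      (∀ i ∈ K, f q₀ i = 0) → LinearIndepOn ℝ (g q) ((K ∪ S : Finset ι) : Set ι) →
      ∀ w ∈ coeffCone s (K ∪ S), ‖w‖ ≤ C * ‖∑ i, w i • g q i‖ := by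
    intro K
    by_cases hdep : ∃ w ∈ coeffCone s (K ∪ S), w ≠ 0 ∧ ∑ i, w i • g q₀ i = 0
    · refine ⟨0, le_rfl, ?_⟩
      filter_upwards [hU] with q hq hqΩ hKs hK0 hli
      exact absurd hli (hK K hKs hK0 hdep q hq hqΩ)
    · push Not at hdep
      obtain ⟨c, hc, hev⟩ := eventually_mul_norm_le_of_coeffCone hg s (K ∪ S)
        fun w hw h0 => by
          by_contra hne
          exact hdep w hw hne h0
      refine ⟨c⁻¹, (inv_pos.2 hc).le, ?_⟩
      filter_upwards [hev] with q hq _ _ _ _ w hw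
      rw [inv_mul_eq_div, le_div_iff₀ hc, mul_comm]
      exact hq w hw
  choose C hC0 hC using hbound
  refine ⟨∑ K, C K, ?_⟩
  -- Inequalities inactive at `q₀` remain strictly satisfied nearby, so only active ones can be
  -- violated.
  have hactive : ∀ᶠ q in 𝓝 q₀, ∀ i ∈ s, 0 < f q i → f q₀ i = 0 := by
    refine (Filter.eventually_all_finset s).2 fun i hi => ?_
    rcases (hf₀ i hi).eq_or_lt with h | h
    · exact Filter.Eventually.of_forall fun q _ => h
    · filter_upwards [(continuousAt_pi.1 hf i).eventually_lt_const h] with q hq hq'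
      exact absurd hq' hq.not_gt
  filter_upwards [hU, hactive, eventually_linearIndepOn hg hS, Filter.eventually_all.2 hC]
    with q hqU hqa hqS hqC hqΩ w hw hwf
  have hspanq := span_image_eq_of_finrank_eq (J := sᶜ)
    (fun i hi => Finset.mem_compl.2 (Finset.disjoint_right.1 hsS hi)) hqS
    ((hr q hqU hqΩ).trans hcard)
  obtain ⟨w₁, hw₁, hsum₁⟩ := exists_mem_coeffCone_sum_eq hsS hspanq hw
  obtain ⟨K, hKsub, w₂, hw₂, hli, hsum₂⟩ := exists_linearIndepOn_conic_comb (g q) hsS hqS _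
    (Finset.filter_subset _ _) w₁ hw₁
  have hKs : ∀ i ∈ K, i ∈ s ∧ w i ≠ 0 := fun i hi => Finset.mem_filter.1 (hKsub hi)
  refine ⟨w₂, hw₂.1, fun i hi hne => ?_, hsum₂.trans hsum₁, ?_⟩
  · have : i ∈ K ∪ S := by
      by_contra hcon
      exact hne (hw₂.2 i hcon)
    have hiK := (Finset.mem_union.1 this).resolve_right (Finset.disjoint_left.1 hsS hi)
    exact hwf i hi (hKs i hiK).2
  · have h1 := hqC K hqΩ (fun i hi => (hKs i hi).1)
      (fun i hi => hqa i (hKs i hi).1 (hwf i (hKs i hi).1 (hKs i hi).2)) hli w₂ hw₂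
    rw [hsum₂, hsum₁] at h1
    exact h1.trans (mul_le_mul_of_nonneg_right
      (Finset.single_le_sum (fun K _ => hC0 K) (Finset.mem_univ K)) (norm_nonneg _))

end LinearAlgebra

/-! ### Quadratic penalty and the distance estimate -/

section Penalty

open Filter

variable {ι E : Type*} [NormedAddCommGroup E] [InnerProductSpace ℝ E]

/-- The gradient inequality for convex functions. -/
theorem ConvexOn.inner_gradient_le [CompleteSpace E] {F : E → ℝ} (hF : ConvexOn ℝ Set.univ F)
    {g z : E} (hg : HasGradientAt F g z) (y : E) : inner ℝ g (y - z) ≤ F y - F z := by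
  let φ : ℝ → ℝ := fun t => F (AffineMap.lineMap z y t)
  have hφ : ConvexOn ℝ Set.univ φ := by
    have := hF.comp_affineMap (AffineMap.lineMap z y : ℝ →ᵃ[ℝ] E)
    rwa [Set.preimage_univ] at this
  have hd : HasDerivAt φ (inner ℝ g (y - z)) 0 := by
    have h1 : HasDerivAt (fun t : ℝ => AffineMap.lineMap z y t) (y - z) 0 :=
      AffineMap.hasDerivAt_lineMap
    have h2 : HasFDerivAt F (InnerProductSpace.toDual ℝ E g)
        (AffineMap.lineMap z y (0 : ℝ)) := by
      simpa using hg.hasFDerivAt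
    have := h2.comp_hasDerivAt (0 : ℝ) h1
    rwa [InnerProductSpace.toDual_apply_apply] at this
  have := hφ.le_slope_of_hasDerivAt (Set.mem_univ 0) (Set.mem_univ 1) one_pos hd
  simpa [slope_def_field, φ] using this

section MinimizerSequence

variable [Fintype ι]

/-- The quadratic penalty function for the projection of `y` onto the common zero set of `e`. -/
def projPenalty (e : ι → E → ℝ) (y : E) (ρ : ℝ) (u : E) : ℝ :=
  ‖u - y‖ ^ 2 + ρ * ∑ i, e i u ^ 2

theorem exists_tendsto_isMin_projPenalty [FiniteDimensional ℝ E] {e : ι → E → ℝ}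
    (he : ∀ i, Continuous (e i)) {p₀ : E} (hp₀ : ∀ i, e i p₀ = 0) (y : E) :
    ∃ p, (∀ i, e i p = 0) ∧ ∃ z : ℕ → E, Tendsto z atTop (𝓝 p) ∧ ∃ ρ : ℕ → ℝ, ∀ k, 0 < ρ k ∧
      ∀ u, projPenalty e y (ρ k) (z k) ≤ projPenalty e y (ρ k) u := by
  -- Outside this ball the distance term alone exceeds the penalty value at `p₀`, so a minimizer
  -- over the ball is global.
  have hmin : ∀ k : ℕ, ∃ z ∈ Metric.closedBall y ‖p₀ - y‖,
      ∀ u, projPenalty e y (k + 1) z ≤ projPenalty e y (k + 1) u := by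
    intro k
    have hcont : Continuous (projPenalty e y (k + 1)) := by
      unfold projPenalty; fun_prop
    have hp₀mem : p₀ ∈ Metric.closedBall y ‖p₀ - y‖ := by simp [dist_eq_norm]
    obtain ⟨z, hz, hzmin⟩ := (isCompact_closedBall y ‖p₀ - y‖).exists_isMinOn
      ⟨p₀, hp₀mem⟩ hcont.continuousOn
    refine ⟨z, hz, fun u => ?_⟩
    by_cases hu : u ∈ Metric.closedBall y ‖p₀ - y‖
    · exact hzmin hu
    · refine (hzmin hp₀mem).trans ?_
      rw [Metric.mem_closedBall, dist_eq_norm, not_le] at hu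
      have h1 : 0 ≤ ((k : ℝ) + 1) * ∑ i, e i u ^ 2 :=
        mul_nonneg (by positivity) (Finset.sum_nonneg fun i _ => sq_nonneg _)
      have h2 : ‖p₀ - y‖ ^ 2 ≤ ‖u - y‖ ^ 2 := by gcongr
      simp only [projPenalty, hp₀]
      simp only [ne_eq, OfNat.ofNat_ne_zero, not_false_eq_true, zero_pow, Finset.sum_const_zero,
        mul_zero, add_zero]
      linarith
  choose z hz hzmin using hmin
  obtain ⟨p, -, φ, hφ, hlim⟩ := (isCompact_closedBall y ‖p₀ - y‖).tendsto_subseq hz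
  refine ⟨p, fun i => ?_, z ∘ φ, hlim, fun k => (φ k : ℝ) + 1,
    fun k => ⟨by positivity, hzmin (φ k)⟩⟩
  -- Comparison with the feasible point `p₀`; the weight `k + 1` forces the residuals to zero.
  have hbd : ∀ k, e i (z k) ^ 2 ≤ ‖p₀ - y‖ ^ 2 * (1 / ((k : ℝ) + 1)) := by
    intro k
    have h1 := hzmin k p₀
    simp only [projPenalty, hp₀, ne_eq, OfNat.ofNat_ne_zero, not_false_eq_true, zero_pow,
      Finset.sum_const_zero, mul_zero, add_zero] at h1
    have h2 : e i (z k) ^ 2 ≤ ∑ j, e j (z k) ^ 2 :=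
      Finset.single_le_sum (f := fun j => e j (z k) ^ 2) (fun j _ => sq_nonneg _)
        (Finset.mem_univ i)
    rw [mul_one_div, le_div_iff₀ (by positivity)]
    have h3 := mul_le_mul_of_nonneg_left h2 (by positivity : (0 : ℝ) ≤ (k : ℝ) + 1)
    nlinarith [sq_nonneg ‖z k - y‖]
  have h0 : Tendsto (fun k => e i ((z ∘ φ) k) ^ 2) atTop (𝓝 0) := by
    have h1 : Tendsto (fun k : ℕ => ‖p₀ - y‖ ^ 2 * (1 / ((k : ℝ) + 1))) atTop (𝓝 0) := by
      simpa using tendsto_one_div_add_atTop_nhds_zero_nat.const_mul (‖p₀ - y‖ ^ 2)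
    exact squeeze_zero (fun k => sq_nonneg _) (fun k => hbd (φ k)) (h1.comp hφ.tendsto_atTop)
  have h1 : Tendsto (fun k => e i ((z ∘ φ) k) ^ 2) atTop (𝓝 (e i p ^ 2)) :=
    (((he i).tendsto p).comp hlim).pow 2
  exact pow_eq_zero_iff two_ne_zero |>.1 (tendsto_nhds_unique h1 h0)

end MinimizerSequence

variable [DecidableEq ι]

/-- The residuals of the constraints `f i ≤ 0` for `i ∈ s` and `f i = 0` for `i ∉ s`. -/
def constrResidual (s : Finset ι) (f : ι → E → ℝ) (i : ι) (z : E) : ℝ :=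
  if i ∈ s then max 0 (f i z) else f i z

/-- Squaring removes the kink: at `0` the function is dominated by `u ^ 2`, which is `o(u)`. This
makes the penalty differentiable. -/
theorem hasDerivAt_max_zero_sq (t : ℝ) :
    HasDerivAt (fun t : ℝ => max 0 t ^ 2) (2 * max 0 t) t := by
  rcases lt_trichotomy t 0 with h | rfl | h
  · rw [max_eq_left h.le, mul_zero]
    refine (hasDerivAt_const t (0 : ℝ)).congr_of_eventuallyEq ?_
    filter_upwards [Iio_mem_nhds h] with u hu
    simp [max_eq_left (Set.mem_Iio.1 hu).le]
  · rw [max_self, mul_zero, hasDerivAt_iff_isLittleO]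
    have h1 : (fun u : ℝ => u ^ 2) =o[𝓝 0] fun u : ℝ => u := by
      simpa using Asymptotics.isLittleO_pow_pow (𝕜 := ℝ) (m := 1) (n := 2) (by norm_num)
    refine Asymptotics.IsBigO.trans_isLittleO (g := fun u : ℝ => u ^ 2) ?_ (by simpa using h1)
    refine Asymptotics.IsBigO.of_bound 1 (Eventually.of_forall fun u => ?_)
    rcases le_total u 0 with hu | hu
    · simp [max_eq_left hu, sq_nonneg]
    · simp [max_eq_right hu]
  · rw [max_eq_right h.le]
    have h1 : HasDerivAt (fun u : ℝ => u ^ 2) (2 * t) t := by simpa using hasDerivAt_pow 2 t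
    refine h1.congr_of_eventuallyEq ?_
    filter_upwards [Ioi_mem_nhds h] with u hu
    rw [max_eq_right (Set.mem_Ioi.1 hu).le]

theorem hasFDerivAt_constrResidual_sq [CompleteSpace E] (s : Finset ι) {f : ι → E → ℝ} {i : ι} {z g : E}
    (hf : HasGradientAt (f i) g z) :
    HasFDerivAt (fun u => constrResidual s f i u ^ 2)
      ((2 * constrResidual s f i z) • InnerProductSpace.toDual ℝ E g) z := by
  have hf' := hf.hasFDerivAt
  by_cases hi : i ∈ s
  · simp only [constrResidual, if_pos hi]
    exact (hasDerivAt_max_zero_sq (f i z)).comp_hasFDerivAt z hf'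
  · simp only [constrResidual, if_neg hi]
    have h1 : HasDerivAt (fun u : ℝ => u ^ 2) (2 * f i z) (f i z) := by
      simpa using hasDerivAt_pow 2 (f i z)
    exact h1.comp_hasFDerivAt z hf'

variable [Fintype ι]

/-- Stationarity of a minimizer of the penalty function. -/
theorem sub_eq_sum_of_isMin_projPenalty [CompleteSpace E] {s : Finset ι} {f : ι → E → ℝ}
    {y z : E} {ρ : ℝ} {g : ι → E} (hf : ∀ i, HasGradientAt (f i) (g i) z)
    (hmin : ∀ u, projPenalty (constrResidual s f) y ρ z ≤ projPenalty (constrResidual s f) y ρ u) :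
    y - z = ∑ i, (ρ * constrResidual s f i z) • g i := by
  have h1 : HasFDerivAt (fun u => ‖u - y‖ ^ 2)
      ((2 : ℝ) • InnerProductSpace.toDual ℝ E (z - y)) z := by
    have := ((hasFDerivAt_id z).sub_const y).norm_sq
    refine this.congr_fderiv ?_
    ext d
    simp [two_smul]
  have h2 := h1.add ((HasFDerivAt.fun_sum (u := Finset.univ) fun i _ =>
    hasFDerivAt_constrResidual_sq s (hf i)).const_mul ρ)
  have h3 : IsLocalMin (projPenalty (constrResidual s f) y ρ) z := Eventually.of_forall hmin
  have h4 := h3.hasFDerivAt_eq_zero h2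
  refine ext_inner_right ℝ fun d => ?_
  have h5 := congrArg (fun L : E →L[ℝ] ℝ => L d) h4
  simp only [add_apply, smul_apply,
    sum_apply, InnerProductSpace.toDual_apply_apply, smul_eq_mul,
    zero_apply] at h5
  rw [sum_inner]
  simp only [inner_smul_left, conj_trivial]
  have h6 : inner ℝ (y - z) d = - inner ℝ (z - y) d := by
    rw [← inner_neg_left, neg_sub]
  have h7 : ρ * ∑ i, 2 * constrResidual s f i z * inner ℝ (g i) d =
      2 * ∑ i, ρ * constrResidual s f i z * inner ℝ (g i) d := by
    rw [Finset.mul_sum, Finset.mul_sum]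
    exact Finset.sum_congr rfl fun i _ => by ring
  rw [h7] at h5
  linarith

/-- The distance of two points is bounded by residuals if their difference is a combination of
gradients with controlled multipliers. -/
theorem norm_sub_le_of_bounded_multipliers [CompleteSpace E] {s : Finset ι} {f : ι → E → ℝ}
    (hconv : ∀ i ∈ s, ConvexOn ℝ Set.univ (f i))
    (haff : ∀ i ∉ s, ConvexOn ℝ Set.univ (f i) ∧ ConvexOn ℝ Set.univ (fun u => - f i u))
    {y z : E} {g : ι → E} (hf : ∀ i, HasGradientAt (f i) (g i) z) {w : ι → ℝ} {C V : ℝ}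
    (hC0 : 0 ≤ C)
    (hw : ∀ i ∈ s, 0 ≤ w i) (hwf : ∀ i ∈ s, w i ≠ 0 → 0 < f i z)
    (hsum : y - z = ∑ i, w i • g i) (hC : ‖w‖ ≤ C * ‖y - z‖)
    (hV : ∀ i, |constrResidual s f i y| ≤ V) :
    ‖y - z‖ ≤ C * ∑ i, (V + |constrResidual s f i z|) := by
  have hnn : 0 ≤ ∑ i, (V + |constrResidual s f i z|) := Finset.sum_nonneg fun i _ =>
    add_nonneg ((abs_nonneg _).trans (hV i)) (abs_nonneg _)
  rcases (norm_nonneg (y - z)).eq_or_lt with h0 | hpos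
  · rw [← h0]
    exact mul_nonneg hC0 hnn
  have hterm : ∀ i, w i * inner ℝ (g i) (y - z) ≤ ‖w‖ * (V + |constrResidual s f i z|) := by
    intro i
    have hVi := hV i
    have hwi : |w i| ≤ ‖w‖ := norm_le_pi_norm w i
    have hV0 : 0 ≤ V := (abs_nonneg _).trans hVi
    by_cases hi : i ∈ s
    -- A nonzero weight forces `f i z > 0`, so the term `-f i z` of the gradient inequality can be
    -- dropped.
    · have h1 : w i * inner ℝ (g i) (y - z) ≤ w i * V := by
        by_cases hwi0 : w i = 0
        · simp [hwi0]
        refine mul_le_mul_of_nonneg_left ?_ (hw i hi)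
        have h2 := (hconv i hi).inner_gradient_le (hf i) y
        have h3 := hwf i hi hwi0
        have h4 : f i y ≤ constrResidual s f i y := by simp [constrResidual, hi]
        linarith [le_abs_self (constrResidual s f i y)]
      refine h1.trans ?_
      exact mul_le_mul ((le_abs_self _).trans hwi) (by linarith [abs_nonneg (constrResidual s f i z)])
        hV0 (norm_nonneg _)
    · have h1 := (haff i hi).1.inner_gradient_le (hf i) y
      have h2 := (haff i hi).2.inner_gradient_le (g := - g i) (z := z)
        (by
          rw [hasGradientAt_iff_hasFDerivAt, map_neg]
          exact (hf i).hasFDerivAt.fun_neg) y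
      rw [inner_neg_left] at h2
      have h3 : |inner ℝ (g i) (y - z)| ≤ V + |constrResidual s f i z| := by
        have h4 : constrResidual s f i y = f i y := by simp [constrResidual, hi]
        have h5 : constrResidual s f i z = f i z := by simp [constrResidual, hi]
        rw [h4] at hVi
        rw [h5, abs_le]
        have := abs_le.1 hVi
        constructor <;> linarith [le_abs_self (f i z), neg_abs_le (f i z)]
      calc w i * inner ℝ (g i) (y - z) ≤ |w i * inner ℝ (g i) (y - z)| := le_abs_self _
        _ = |w i| * |inner ℝ (g i) (y - z)| := abs_mul _ _
        _ ≤ _ := mul_le_mul hwi h3 (abs_nonneg _) (norm_nonneg _)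
  have hsq : ‖y - z‖ ^ 2 ≤ ‖w‖ * ∑ i, (V + |constrResidual s f i z|) := by
    have h1 : ‖y - z‖ ^ 2 = ∑ i, w i * inner ℝ (g i) (y - z) := by
      rw [← real_inner_self_eq_norm_sq]
      -- Only one factor of the inner product is to be expanded; the last rewrite restores the
      -- other.
      conv_lhs => rw [hsum, sum_inner, ← hsum]
      simp only [inner_smul_left, conj_trivial]
    rw [h1, Finset.mul_sum]
    exact Finset.sum_le_sum fun i _ => hterm i
  have h2 := hsq.trans (mul_le_mul_of_nonneg_right hC hnn)
  have h3 : ‖y - z‖ * ‖y - z‖ ≤ ‖y - z‖ * (C * ∑ i, (V + |constrResidual s f i z|)) := by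
    nlinarith
  exact le_of_mul_le_mul_left h3 hpos

end Penalty

/-! ### Outer semicontinuity and uniform constants -/

section Semicontinuity

open Filter

/-- Zero sets of a nonnegative function that does not increase along segments towards zeros are
outer semicontinuous at parameters where the zero set is compact, provided the function is
continuous near that zero set. -/
theorem eventually_zeroSet_subset_thickening {X E : Type*} [TopologicalSpace X]
    [NormedAddCommGroup E] [NormedSpace ℝ E] [FiniteDimensional ℝ E] {R : X → E → ℝ} {x₀ : X}
    (hnn : ∀ x z, 0 ≤ R x z)
    (hseg : ∀ x y₀ y, R x y = 0 → ∀ z ∈ segment ℝ y₀ y, R x z ≤ R x y₀)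
    {O : Set (X × E)} (hO : IsOpen O) (hcont : ContinuousOn (fun q => R q.1 q.2) O)
    {K : Set E} (hK : IsCompact K) (hne : K.Nonempty) (hKR : ∀ z, z ∈ K ↔ R x₀ z = 0)
    (hKO : ∀ z ∈ K, (x₀, z) ∈ O) {η : ℝ} (hη : 0 < η) :
    ∀ᶠ x in 𝓝 x₀, ∀ z, R x z = 0 → z ∈ Metric.thickening η K := by
  obtain ⟨y₀, hy₀⟩ := hne
  have hcont' : ∀ z, (x₀, z) ∈ O → ContinuousAt (fun q : X × E => R q.1 q.2) (x₀, z) :=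
    fun z hz => hcont.continuousAt (hO.mem_nhds hz)
  obtain ⟨δ₁, hδ₁, hsub⟩ := hK.exists_cthickening_subset_open
    (hO.preimage (Continuous.prodMk_right x₀)) hKO
  set δ := min δ₁ (η / 2)
  have hδ : 0 < δ := lt_min hδ₁ (half_pos hη)
  have hδη : δ < η := (min_le_right _ _).trans_lt (half_lt_self hη)
  -- A compact shell around `K`, inside the region of continuity. For `x` near `x₀`, `R x` exceeds
  -- `c` on the shell but is below `c` at `y₀`. The segment from `y₀ ∈ K` to a zero far from `K`
  -- would cross the shell, where `R x` is at most `R x y₀`.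
  let N := {z | Metric.infDist z K = δ}
  have hNsub : N ⊆ Metric.cthickening δ K := fun z hz => by
    rw [Metric.cthickening_eq_preimage_infEDist, Set.mem_preimage, ← ENNReal.ofReal_toReal
      (Metric.infEDist_ne_top ⟨y₀, hy₀⟩)]
    exact ENNReal.ofReal_le_ofReal (le_of_eq hz)
  have hN : IsCompact N := hK.cthickening.of_isClosed_subset
    (isClosed_eq (Metric.continuous_infDist_pt K) continuous_const) hNsub
  have hNO : ∀ z ∈ N, (x₀, z) ∈ O := fun z hz =>
    hsub (Metric.cthickening_mono (min_le_left _ _) _ (hNsub hz))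
  have hNpos : ∀ z ∈ N, 0 < R x₀ z := fun z hz => by
    refine (hnn x₀ z).lt_of_ne fun h0 => ?_
    have h1 : Metric.infDist z K = 0 := Metric.infDist_zero_of_mem ((hKR z).2 h0.symm)
    exact hδ.ne' ((show Metric.infDist z K = δ from hz).symm.trans h1)
  obtain ⟨c, hc, hcN⟩ : ∃ c > 0, ∀ z ∈ N, c < R x₀ z := by
    rcases N.eq_empty_or_nonempty with he | hNne
    · exact ⟨1, one_pos, by simp [he]⟩
    · have hRN : ContinuousOn (R x₀) N := fun z hz =>
        ((hcont' z (hNO z hz)).comp (f := fun z => (x₀, z))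
          (Continuous.prodMk_right x₀).continuousAt).continuousWithinAt
      obtain ⟨z₁, hz₁, hmin⟩ := hN.exists_isMinOn hNne hRN
      exact ⟨R x₀ z₁ / 2, half_pos (hNpos z₁ hz₁), fun z hz =>
        (half_lt_self (hNpos z₁ hz₁)).trans_le (hmin hz)⟩
  have hev₁ : ∀ᶠ x in 𝓝 x₀, ∀ z ∈ N, c < R x z :=
    hN.eventually_forall_of_forall_eventually fun z hz =>
      (hcont' z (hNO z hz)).eventually_const_lt (hcN z hz)
  have hev₂ : ∀ᶠ x in 𝓝 x₀, R x y₀ < c := by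
    have h1 : ContinuousAt (fun x => R x y₀) x₀ :=
      (hcont' y₀ (hKO y₀ hy₀)).comp (f := fun x => (x, y₀))
        (Continuous.prodMk_left y₀).continuousAt
    exact h1.eventually_lt_const (((hKR y₀).1 hy₀).trans_lt hc)
  filter_upwards [hev₁, hev₂] with x hx₁ hx₂ y hy
  rw [Metric.mem_thickening_iff_infEDist_lt, ← ENNReal.ofReal_toReal
    (Metric.infEDist_ne_top ⟨y₀, hy₀⟩), ENNReal.ofReal_lt_ofReal_iff hη]
  change Metric.infDist y K < η
  by_contra! hge
  have hpath : ContinuousOn (fun t : ℝ => Metric.infDist (AffineMap.lineMap y₀ y t) K)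
      (Set.Icc 0 1) :=
    ((Metric.continuous_infDist_pt K).comp AffineMap.lineMap_continuous).continuousOn
  obtain ⟨t, ht, htδ⟩ := intermediate_value_Icc zero_le_one hpath
    (show δ ∈ Set.Icc _ _ by
      simp only [AffineMap.lineMap_apply_zero, AffineMap.lineMap_apply_one]
      exact ⟨by rw [Metric.infDist_zero_of_mem hy₀]; exact hδ.le, hδη.le.trans hge⟩)
  have h1 := hx₁ _ htδ
  have h2 := hseg x y₀ y hy (AffineMap.lineMap y₀ y t) (by
    rw [segment_eq_image_lineMap]
    exact ⟨t, ht, rfl⟩)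
  linarith

/-- A property that holds, with some constant, near each point of `{x₀} × K` with `K` compact holds
with one constant near `{x₀} × K`. -/
theorem exists_uniform_const_of_isCompact {X E : Type*} [TopologicalSpace X]
    [NormedAddCommGroup E] [NormedSpace ℝ E] [FiniteDimensional ℝ E] {x₀ : X} {K : Set E}
    (hK : IsCompact K) {P : ℝ → X → E → Prop}
    (hmono : ∀ C C' x z, C ≤ C' → P C x z → P C' x z)
    (hP : ∀ z ∈ K, ∃ C, ∀ᶠ q : X × E in 𝓝 (x₀, z), P C q.1 q.2) :
    ∃ C, 0 ≤ C ∧ ∃ δ > 0, ∀ᶠ x in 𝓝 x₀, ∀ z ∈ Metric.cthickening δ K, P C x z := by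
  have hunif : ∃ C, ∀ z ∈ K, ∀ᶠ q : X × E in 𝓝 (x₀, z), P C q.1 q.2 := by
    refine hK.induction_on (p := fun s => ∃ C, ∀ z ∈ s, ∀ᶠ q : X × E in 𝓝 (x₀, z), P C q.1 q.2)
      ⟨0, by simp⟩ ?_ ?_ ?_
    · rintro s t hst ⟨C, hC⟩
      exact ⟨C, fun z hz => hC z (hst hz)⟩
    · rintro s t ⟨C, hC⟩ ⟨C', hC'⟩
      refine ⟨max C C', fun z hz => ?_⟩
      rcases hz with hz | hz
      · exact (hC z hz).mono fun q => hmono _ _ _ _ (le_max_left _ _)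
      · exact (hC' z hz).mono fun q => hmono _ _ _ _ (le_max_right _ _)
    · intro z hz
      obtain ⟨C, hC⟩ := hP z hz
      -- A property holding near `(x₀, z)` also holds near `(x₀, z')` for every `z'` close to `z`,
      -- with the same constant.
      exact ⟨_, mem_nhdsWithin_of_mem_nhds ((Continuous.prodMk_right x₀).continuousAt
        (eventually_eventually_nhds.2 hC)), C, fun z' hz' => hz'⟩
  obtain ⟨C, hC⟩ := hunif
  have hC' : ∀ z ∈ K, ∀ᶠ q : X × E in 𝓝 (x₀, z), P (max C 0) q.1 q.2 := fun z hz =>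
    (hC z hz).mono fun q => hmono _ _ _ _ (le_max_left _ _)
  obtain ⟨δ, hδ, hsub⟩ := hK.exists_cthickening_subset_open
    ((isOpen_setOfPred_eventually_nhds (p := fun q : X × E => P (max C 0) q.1 q.2)).preimage
      (Continuous.prodMk_right x₀)) hC'
  exact ⟨max C 0, le_max_right _ _, δ, hδ,
    hK.cthickening.eventually_forall_of_forall_eventually fun z hz => hsub hz⟩

end Semicontinuity

/-! ### Application to the feasible set mapping -/

namespace ParametricConstraints

open Filter

variable {n m p ℓ : ℕ} {h : Fin p → EuclideanSpace ℝ (Fin n) → EuclideanSpace ℝ (Fin m) → ℝ}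

theorem eqIdx_eq_compl : eqIdx p ℓ = (ineqIdx p ℓ)ᶜ := by
  ext i; simp [eqIdx, ineqIdx]

theorem mem_feasMap_iff_constrResidual {x : EuclideanSpace ℝ (Fin n)}
    {y : EuclideanSpace ℝ (Fin m)} :
    y ∈ feasMap ℓ h x ↔ ∀ i, constrResidual (ineqIdx p ℓ) (fun i => h i x) i y = 0 := by
  simp only [feasMap, eqIdx_eq_compl, Finset.mem_compl, Set.mem_ofPred_eq, constrResidual]
  constructor
  · rintro ⟨h1, h2⟩ i
    split_ifs with hi
    · exact max_eq_left (h1 i hi)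
    · exact h2 i hi
  · intro h1
    exact ⟨fun i hi => by simpa [hi] using h1 i, fun i hi => by simpa [hi] using h1 i⟩

theorem abs_constrResidual_le_violation (x : EuclideanSpace ℝ (Fin n))
    (y : EuclideanSpace ℝ (Fin m)) (i : Fin p) :
    |constrResidual (ineqIdx p ℓ) (fun i => h i x) i y| ≤ violation ℓ h x y := by
  unfold constrResidual violation
  split_ifs with hi
  · rw [abs_of_nonneg (le_max_left _ _)]
    refine max_le_max le_rfl (le_max_of_le_left ?_)
    exact le_ciSup (f := fun i : ineqIdx p ℓ => h i x y) (Set.finite_range _).bddAbove ⟨i, hi⟩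
  · refine le_max_of_le_right (le_max_of_le_right ?_)
    exact le_ciSup (f := fun i : eqIdx p ℓ => |h i x y|) (Set.finite_range _).bddAbove
      ⟨i, by simpa [eqIdx_eq_compl] using hi⟩

theorem convexOn_of_eq_affineMap {E : Type*} [AddCommGroup E] [Module ℝ E] {F : E → ℝ}
    (hF : ∃ A : E →ᵃ[ℝ] ℝ, ∀ y, F y = A y) :
    ConvexOn ℝ Set.univ F ∧ ConvexOn ℝ Set.univ fun u => - F u := by
  obtain ⟨A, hA⟩ := hF
  obtain rfl : F = A := funext hA
  exact ⟨by simpa using (convexOn_id (𝕜 := ℝ) convex_univ).comp_affineMap A,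
    ((concaveOn_id (𝕜 := ℝ) convex_univ).comp_affineMap A).neg⟩

/-- The absolute residual is convex, as a maximum of convex functions, and vanishes at `y`; on the
segment it is at most its larger endpoint value. -/
theorem abs_constrResidual_le_of_mem_segment {ι E : Type*} [DecidableEq ι] [NormedAddCommGroup E]
    [InnerProductSpace ℝ E] {s : Finset ι} {f : ι → E → ℝ}
    (hconv : ∀ i ∈ s, ConvexOn ℝ Set.univ (f i))
    (haff : ∀ i ∉ s, ConvexOn ℝ Set.univ (f i) ∧ ConvexOn ℝ Set.univ (fun u => - f i u))
    {i : ι} {y₀ y z : E} (hy : constrResidual s f i y = 0) (hz : z ∈ segment ℝ y₀ y) :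
    |constrResidual s f i z| ≤ |constrResidual s f i y₀| := by
  have key : ConvexOn ℝ Set.univ fun u => |constrResidual s f i u| := by
    by_cases hi : i ∈ s
    · have h1 := (convexOn_const (0 : ℝ) convex_univ).sup (hconv i hi)
      refine h1.congr fun u _ => ?_
      simp [constrResidual, hi, abs_of_nonneg (le_max_left 0 (f i u))]
    · have h1 := (haff i hi).1.sup (haff i hi).2
      refine h1.congr fun u _ => ?_
      simp [constrResidual, hi, abs_eq_max_neg]
  have h1 := key.le_max_of_mem_segment (Set.mem_univ y₀) (Set.mem_univ y) hz
  simpa [hy] using h1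

/-- The constraint functions are differentiable at `(x, y)` and, if `x` lies in `Ω`, every
combination of their gradients with nonnegative multipliers on violated inequality constraints has
a representation of the same kind with multipliers bounded by `C` times its norm. -/
def HasBoundedMultipliers (ℓ : ℕ)
    (h : Fin p → EuclideanSpace ℝ (Fin n) → EuclideanSpace ℝ (Fin m) → ℝ)
    (Ω : Set (EuclideanSpace ℝ (Fin n))) (C : ℝ) (x : EuclideanSpace ℝ (Fin n))
    (y : EuclideanSpace ℝ (Fin m)) : Prop :=
  (∀ i, HasGradientAt (h i x) (gradY h i x y) y) ∧ (x ∈ Ω →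
    ∀ w : Fin p → ℝ, (∀ i ∈ ineqIdx p ℓ, 0 ≤ w i) → (∀ i ∈ ineqIdx p ℓ, w i ≠ 0 → 0 < h i x y) →
    ∃ w' : Fin p → ℝ, (∀ i ∈ ineqIdx p ℓ, 0 ≤ w' i) ∧
      (∀ i ∈ ineqIdx p ℓ, w' i ≠ 0 → 0 < h i x y) ∧
      ∑ i, w' i • gradY h i x y = ∑ i, w i • gradY h i x y ∧
      ‖w'‖ ≤ C * ‖∑ i, w i • gradY h i x y‖)

theorem HasBoundedMultipliers.mono {Ω : Set (EuclideanSpace ℝ (Fin n))} {C C' : ℝ}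
    {x : EuclideanSpace ℝ (Fin n)} {y : EuclideanSpace ℝ (Fin m)} (hCC' : C ≤ C')
    (hP : HasBoundedMultipliers ℓ h Ω C x y) : HasBoundedMultipliers ℓ h Ω C' x y :=
  ⟨hP.1, fun hx w hw hwf => by
    obtain ⟨w', h1, h2, h3, h4⟩ := hP.2 hx w hw hwf
    exact ⟨w', h1, h2, h3, h4.trans (mul_le_mul_of_nonneg_right hCC' (norm_nonneg _))⟩⟩

/-- The local consequence of the constraint qualification that is used for the error bound. -/
theorem RCPLD.exists_bounded_multipliers {x₀ : EuclideanSpace ℝ (Fin n)}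
    (hsmooth : SmoothNear ℓ h x₀) {Ω : Set (EuclideanSpace ℝ (Fin n))} (hx₀ : x₀ ∈ Ω)
    {y₀ : EuclideanSpace ℝ (Fin m)} (hy₀ : y₀ ∈ feasMap ℓ h x₀) (hR : RCPLD ℓ h Ω x₀ y₀) :
    ∃ C : ℝ, ∀ᶠ q : EuclideanSpace ℝ (Fin n) × EuclideanSpace ℝ (Fin m) in 𝓝 (x₀, y₀),
      HasBoundedMultipliers ℓ h Ω C q.1 q.2 := by
  obtain ⟨O, hO, hsub, hsm⟩ := hsmooth
  have hmem : (x₀, y₀) ∈ O := hsub ⟨rfl, hy₀⟩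
  have hOn := hO.mem_nhds hmem
  obtain ⟨U, hU, S, hSJ, ⟨hli, hspan⟩, ⟨r, hr⟩, hK⟩ := hR
  rw [eqIdx_eq_compl] at hSJ hspan hr
  have hdisj : Disjoint (ineqIdx p ℓ) S :=
    Finset.disjoint_right.2 fun i hi => Finset.mem_compl.1 (hSJ hi)
  obtain ⟨C, hC⟩ := exists_eventually_bounded_multipliers
    (g := fun q : EuclideanSpace ℝ (Fin n) × EuclideanSpace ℝ (Fin m) => fun i =>
      gradY h i q.1 q.2)
    (f := fun q i => h i q.1 q.2) (q₀ := (x₀, y₀)) (Ω := {q | q.1 ∈ Ω}) (s := ineqIdx p ℓ)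
    (S := S) (continuousAt_pi.2 fun i => (hsm i).2.2.continuousAt hOn)
    (continuousAt_pi.2 fun i => (hsm i).1.continuousAt hOn) hx₀ hdisj hy₀.1 hli hspan hU
    (fun q hq hqΩ => hr q.1 q.2 hq hqΩ) (by
      intro K hKs hK0 hw q hq hqΩ
      refine hK K (fun i hi => ⟨hKs hi, hK0 i hi⟩) ?_ q.1 q.2 hq hqΩ
      obtain ⟨w, hw, hwne, hw0⟩ := hw
      refine ⟨fun i => w i, fun i => w i, fun i => hw.1 i (hKs i.2), ?_, ?_⟩
      · obtain ⟨i, hi⟩ := Function.ne_iff.1 hwne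
        have hiKS : i ∈ K ∪ S := by
          by_contra hcon
          exact hi (hw.2 i hcon)
        rcases Finset.mem_union.1 hiKS with h | h
        · exact Or.inl ⟨⟨i, h⟩, hi⟩
        · exact Or.inr ⟨⟨i, h⟩, hi⟩
      · rw [Finset.sum_coe_sort K (fun i => w i • gradY h i x₀ y₀),
          Finset.sum_coe_sort S (fun i => w i • gradY h i x₀ y₀),
          ← Finset.sum_union (hdisj.mono_left hKs), ← hw0]
        exact Finset.sum_subset (Finset.subset_univ _) fun i _ hi => by simp [hw.2 i hi])
  refine ⟨C, ?_⟩
  filter_upwards [hC, hOn] with q hq hqO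
  exact ⟨fun i => ((hsm i).2.1 q hqO).hasGradientAt, hq⟩

/-- Near the reference parameter, the feasible sets lie in any prescribed neighborhood of the
feasible set at the reference parameter. -/
theorem eventually_feasMap_subset_thickening {x₀ : EuclideanSpace ℝ (Fin n)}
    (hx₀ : x₀ ∈ setDom (feasMap ℓ h)) (hsmooth : SmoothNear ℓ h x₀)
    (hconvex : ∀ x, ∀ i ∈ ineqIdx p ℓ, ConvexOn ℝ Set.univ (h i x))
    (haffine : ∀ x, ∀ i ∉ ineqIdx p ℓ, ConvexOn ℝ Set.univ (h i x) ∧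
      ConvexOn ℝ Set.univ fun u => - h i x u)
    (hK : IsCompact (feasMap ℓ h x₀)) {η : ℝ} (hη : 0 < η) :
    ∀ᶠ x in 𝓝 x₀, feasMap ℓ h x ⊆ Metric.thickening η (feasMap ℓ h x₀) := by
  obtain ⟨O, hO, hsub, hsm⟩ := hsmooth
  let R : EuclideanSpace ℝ (Fin n) → EuclideanSpace ℝ (Fin m) → ℝ := fun x z =>
    ∑ i, |constrResidual (ineqIdx p ℓ) (fun i => h i x) i z|
  have hR0 : ∀ x z, z ∈ feasMap ℓ h x ↔ R x z = 0 := fun x z => by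
    rw [mem_feasMap_iff_constrResidual,
      Finset.sum_eq_zero_iff_of_nonneg fun i _ => abs_nonneg _]
    simp
  have hcont : ContinuousOn (fun q : EuclideanSpace ℝ (Fin n) × EuclideanSpace ℝ (Fin m) =>
      R q.1 q.2) O := by
    refine continuousOn_finsetSum _ fun i _ => ContinuousOn.abs ?_
    by_cases hi : i ∈ ineqIdx p ℓ
    · simp only [constrResidual, if_pos hi]
      exact continuousOn_const.sup (hsm i).1
    · simp only [constrResidual, if_neg hi]
      exact (hsm i).1
  have hev := eventually_zeroSet_subset_thickening (R := R) (x₀ := x₀)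
    (fun x z => Finset.sum_nonneg fun i _ => abs_nonneg _)
    (fun x y₀ y hy z hz => Finset.sum_le_sum fun i _ =>
      abs_constrResidual_le_of_mem_segment (hconvex x) (haffine x)
        (mem_feasMap_iff_constrResidual.1 ((hR0 x y).2 hy) i) hz)
    hO hcont hK hx₀ (hR0 x₀) (fun z hz => hsub ⟨rfl, hz⟩) hη
  filter_upwards [hev] with x hx z hz
  exact hx z ((hR0 x z).1 hz)

end ParametricConstraints

theorem mainTheorem1 (n m p ℓ : ℕ) (hℓ : ℓ ≤ p)
    (h : Fin p → EuclideanSpace ℝ (Fin n) → EuclideanSpace ℝ (Fin m) → ℝ)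
    (x₀ : EuclideanSpace ℝ (Fin n))
    (hx₀ : x₀ ∈ setDom (feasMap ℓ h))
    (hsmooth : SmoothNear ℓ h x₀)
    (hconvex : ∀ x, ∀ i ∈ ineqIdx p ℓ, ConvexOn ℝ Set.univ (h i x))
    (haffine : ∀ x, ∀ i ∈ eqIdx p ℓ,
      ∃ A : EuclideanSpace ℝ (Fin m) →ᵃ[ℝ] ℝ, ∀ y, h i x y = A y)
    (hbounded : LocallyBoundedAt (feasMap ℓ h) x₀)
    (hRCPLD : ∀ y₀ ∈ feasMap ℓ h x₀, RCPLD ℓ h (setDom (feasMap ℓ h)) x₀ y₀) :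
    ∀ y₀ ∈ feasMap ℓ h x₀, RRegularAt ℓ h (setDom (feasMap ℓ h)) x₀ y₀ := by
  intro y₀ _
  have haff : ∀ x, ∀ i ∉ ineqIdx p ℓ, ConvexOn ℝ Set.univ (h i x) ∧
      ConvexOn ℝ Set.univ fun u => - h i x u := fun x i hi =>
    convexOn_of_eq_affineMap (haffine x i (by simpa [eqIdx_eq_compl] using hi))
  -- The penalty ranges over the whole space, beyond the set in `hsmooth`; continuity there comes
  -- from convexity in finite dimension.
  have hres : ∀ x i, Continuous (constrResidual (ineqIdx p ℓ) (fun i => h i x) i) := by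
    intro x i
    unfold constrResidual
    by_cases hi : i ∈ ineqIdx p ℓ
    · simp only [if_pos hi]
      exact continuous_const.max (hconvex x i hi).locallyLipschitz.continuous
    · simp only [if_neg hi]
      exact (haff x i hi).1.locallyLipschitz.continuous
  have hK : IsCompact (feasMap ℓ h x₀) := by
    obtain ⟨B, hB, V, hV, hVB⟩ := hbounded
    refine Metric.isCompact_of_isClosed_isBounded ?_ (hB.subset (hVB x₀ (mem_of_mem_nhds hV)))
    have : feasMap ℓ h x₀ =
        ⋂ i, {z | constrResidual (ineqIdx p ℓ) (fun i => h i x₀) i z = 0} := by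
      ext z
      simp [mem_feasMap_iff_constrResidual]
    rw [this]
    exact isClosed_iInter fun i => isClosed_eq (hres x₀ i) continuous_const
  obtain ⟨C, hC0, δ, hδ, hC⟩ := exists_uniform_const_of_isCompact hK
    (P := HasBoundedMultipliers ℓ h (setDom (feasMap ℓ h)))
    (fun _ _ _ _ hCC' hP => hP.mono hCC')
    (fun z hz => (hRCPLD z hz).exists_bounded_multipliers hsmooth hx₀ hz)
  have hev := hC.and (eventually_feasMap_subset_thickening hx₀ hsmooth hconvex haff hK hδ)
  -- Each of the `p` residuals contributes `C` times the violation; adding `1` keeps the constant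
  -- positive. The neighborhood restricts only `x`.
  refine ⟨C * p + 1, by positivity, {q | _}, continuousAt_fst.eventually hev, ?_⟩
  rintro x y ⟨hCx, hΓx⟩ ⟨p₀, hp₀⟩
  obtain ⟨u, hu, z, hz, ρ, hρ⟩ := exists_tendsto_isMin_projPenalty (hres x)
    (mem_feasMap_iff_constrResidual.1 hp₀) y
  have huΓ : u ∈ feasMap ℓ h x := mem_feasMap_iff_constrResidual.2 hu
  have hbound : ∀ᶠ k in Filter.atTop, ‖y - z k‖ ≤ C * ∑ i, (violation ℓ h x y +
      |constrResidual (ineqIdx p ℓ) (fun i => h i x) i (z k)|) := by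
    -- The limit `u` lies in the open thickening of `Γ(x₀)`, hence so do the late minimizers, where
    -- `C` applies.
    filter_upwards [hz.eventually (Metric.isOpen_thickening.mem_nhds (hΓx huΓ))] with k hk
    obtain ⟨hgrad, hmul⟩ := hCx (z k) (Metric.thickening_subset_cthickening _ _ hk)
    have hstat := sub_eq_sum_of_isMin_projPenalty hgrad (hρ k).2
    obtain ⟨w, hw, hwf, hsum, hwC⟩ := hmul ⟨p₀, hp₀⟩
      (fun i => ρ k * constrResidual (ineqIdx p ℓ) (fun i => h i x) i (z k))
      (fun i hi => mul_nonneg (hρ k).1.le (by simp [constrResidual, hi]))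
      (fun i hi hne => by
        by_contra! hle
        exact hne (by simp [constrResidual, hi, hle]))
    rw [← hstat] at hsum hwC
    exact norm_sub_le_of_bounded_multipliers (hconvex x) (haff x) hgrad hC0 hw hwf hsum.symm hwC
      (abs_constrResidual_le_violation x y)
  have hlim : ‖y - u‖ ≤ C * ∑ i, (violation ℓ h x y +
      |constrResidual (ineqIdx p ℓ) (fun i => h i x) i u|) := by
    refine le_of_tendsto_of_tendsto (hz.const_sub y).norm ?_ hbound
    exact (tendsto_finsetSum _ fun i _ =>
      ((((hres x i).tendsto u).comp hz).abs.const_add _)).const_mul C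
  have hviol : 0 ≤ violation ℓ h x y := le_max_left _ _
  refine (Metric.infEDist_le_edist_of_mem huΓ).trans ?_
  rw [edist_dist, dist_eq_norm]
  refine ENNReal.ofReal_le_ofReal (hlim.trans ?_)
  simp only [hu, abs_zero, add_zero, Finset.sum_const, Finset.card_univ, Fintype.card_fin,
    nsmul_eq_mul]
  linarith
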